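/- \textbf{Setting.} Let $n,m,p\in\mathbb N$, $I=\{1,\dots,m\}$, $J=\{1,\dots,p\}$; let $\mathbb R^n$ carry the Euclidean norm, with closed unit ball $\mathbb B$ and open balls $B(x,\rho)$. Let $S\subset\mathbb R^n$ be closed. For $j\in J$ let $\mathcal V_j\subset\mathbb R^{n_j}$ be nonempty and compact and $g_j:\mathbb R^n\times\mathbb R^{n_j}\to\mathbb R$. For $i\in I$ let $f_i^L,f_i^U:\mathbb R^n\to\mathbb R$ be locally Lipschitz with $f_i^L\le f_i^U$ on $S$, and let $0\le\epsilon_i^L\le\epsilon_i^U$ be reals with $\theta:=\sum_{i\in I}(\epsilon_i^L+\epsilon_i^U)>0$. Put $$\varphi(x):=\sum_{i\in I}[f_i^L(x)+f_i^U(x)],\qquad g_j(x):=\max_{v_j\in\mathcal V_j}g_j(x,v_j),\qquad \mathcal V_j(x):=\{v_j\in\mathcal V_j: g_j(x,v_j)=g_j(x)\},$$ $$\Omega:=\{x\in S: g_j(x,v_j)\le0\ \ \forall v_j\in\mathcal V_j,\ \forall j\in J\},\qquad \Omega_{\mathcal E}:=\{x\in S: g_j(x)\le\sqrt\theta\ \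 \forall j\in J\}.$$ For a subset $C$ of a Euclidean space, the limiting normal cone $N(x;C)$ is the set of all $x^*$ for which there are $x_k\to x$ with $x_k\in C$, $\varepsilon_k\to0^+$ and $x_k^*\to x^*$ with $\limsup_{u\to x_k,\,u\in C}\frac{\langle x_k^*,u-x_k\rangle}{\|u-x_k\|}\le\varepsilon_k$ for all $k$. For $h:\mathbb R^n\to\mathbb R$, the limiting subdifferential is $\partial h(x):=\{x^*:(x^*,-1)\in N((x,h(x));\operatorname{epi}h)\}$; $\partial_xg_j(x,v_j)$ denotes the limiting subdifferential of $g_j(\cdot,v_j)$ at $x$, and $\mathrm{co}$ the convex hull. Assume that for every $j\in J$ and every $\bar x\in\mathbb R^n$ there are $\delta>0$ and $K$ such that (C1) for each $x\in B(\bar x,\delta)$ the function $v_j\mapsto g_j(x,v_j)$ is upper semicontinuous on $\mathcal V_j$, and $|g_j(x_1,v_j)-g_j(x_2,v_j)|\le K\|x_1-x_2\|$ for all $x_1,x_2\in B(\bar x,\delta)$ and $v_j\in\mathcal V_j$; (C2) the multifunction $(x,v_j)\in B(\bar x,\delta)\times\mathcal V_j\rightrightarrows\partial_xg_j(x,v_j)$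 is closed at $(\bar x,\bar v_j)$ for each $\bar v_j\in\mathcal V_j(\bar x)$, that is, whenever $(x_k,v_k)\to(\bar x,\bar v_j)$ in $B(\bar x,\delta)\times\mathcal V_j$ and $x_k^*\in\partial_xg_j(x_k,v_k)$ converge to $x^*$, then $x^*\in\partial_xg_j(\bar x,\bar v_j)$. \textbf{Theorem.} Assume that $\Omega\neq\emptyset$ and that $\varphi$ is bounded from below on $S$. Then there exist $z\in\Omega_{\mathcal E}$ and $\lambda\in\mathbb R^p_+$ such that $z$ is an almost regular $\theta$-solution of the problem $\min\{\varphi(x):x\in\Omega\}$, i.e. $$\varphi(z)\le\varphi(x)+\theta\quad\text{and}\quad\varphi(z)\le\varphi(x)+\sqrt\theta\,\|x-z\|\qquad\forall x\in\Omega,$$ and such that $$0\in\partial\varphi(z)+\sum_{j\in J}\lambda_j\,\mathrm{co}\Big(\bigcup_{v_j\in\mathcal V_j(z)}\partial_xg_j(z,v_j)\Big)+N(z;S)+\sqrt\theta\,\mathbb B,$$ $$\lambda_j>0\ \text{ for all } j\in J \text{ with } 0<g_j(z)\le\sqrt\theta,\qquad \lambda_j=0\ \text{ if } g_j(z)\le0.$$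 -/

import Mathlib

open Set Filter Topology
open scoped Pointwise

noncomputable section

/-! ### Limiting normals and subgradients -/

/-- The set of `ε`-normals to `S` at `x`: the vectors `x'` such that the upper limit of
`⟪x', u - x⟫ / ‖u - x‖`, as `u → x` with `u ∈ S`, `u ≠ x`, is at most `ε`. The bound on the upper
limit is written out: for each `η > 0` the quotient is eventually at most `ε + η`. -/
def epsNormals {H : Type*} [NormedAddCommGroup H] [InnerProductSpace ℝ H]
    (ε : ℝ) (x : H) (S : Set H) : Set H :=
  {x' | ∀ η : ℝ, 0 < η → ∀ᶠ u in 𝓝[S] x, inner ℝ x' (u - x) ≤ (ε + η) * ‖u - x‖}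

/-- The limiting (Mordukhovich) normal cone `N(x; S)`. -/
def limitingNormalCone {H : Type*} [NormedAddCommGroup H] [InnerProductSpace ℝ H]
    (x : H) (S : Set H) : Set H :=
  {x' | ∃ (y : ℕ → H) (ε : ℕ → ℝ) (y' : ℕ → H),
      (∀ k, y k ∈ S) ∧ Tendsto y atTop (𝓝 x) ∧
      Tendsto ε atTop (𝓝[>] 0) ∧
      Tendsto y' atTop (𝓝 x') ∧
      ∀ k, y' k ∈ epsNormals (ε k) (y k) S}

/-- The epigraph of a real-valued function, in `H × ℝ` with its Hilbert space structure. -/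
def epigraph {H : Type*} (f : H → ℝ) : Set (WithLp 2 (H × ℝ)) :=
  {q | f q.fst ≤ q.snd}

/-- The limiting (Mordukhovich) subdifferential `∂f(x)` of a real-valued function. -/
def limitingSubdiff {H : Type*} [NormedAddCommGroup H] [InnerProductSpace ℝ H]
    (f : H → ℝ) (x : H) : Set H :=
  {x' | WithLp.toLp 2 (x', (-1 : ℝ)) ∈
    limitingNormalCone (WithLp.toLp 2 (x, f x)) (epigraph f)}

/-! ### Uncertain constraints -/

/-- The worst-case constraint function `x ↦ max_{v ∈ V} g(x, v)`. -/
def worstCase {H W : Type*} (V : Set W) (g : H → W → ℝ) (x : H) : ℝ :=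
  sSup (g x '' V)

/-- The parameters `v ∈ V` that are active at `x`. -/
def activeParams {H W : Type*} (V : Set W) (g : H → W → ℝ) (x : H) : Set W :=
  {v ∈ V | g x v = worstCase V g x}

/-- The two standing conditions on an uncertain constraint `g` at the point `x₀`.
On some ball around `x₀`: `g(x, ·)` is upper semicontinuous on `V`, the functions `g(·, v)`,
`v ∈ V`, are Lipschitz with a common rank `K`, and the multifunction `(x, v) ↦ ∂ₓg(x, v)` is
closed at `(x₀, v₀)` for every parameter `v₀` active at `x₀`. -/
def ConstraintRegularAt {H W : Type*} [NormedAddCommGroup H] [InnerProductSpace ℝ H]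
    [TopologicalSpace W] (V : Set W) (g : H → W → ℝ) (x₀ : H) : Prop :=
  ∃ δ : ℝ, 0 < δ ∧
    (∀ x ∈ Metric.ball x₀ δ, UpperSemicontinuousOn (g x) V) ∧
    (∃ K : ℝ, ∀ v ∈ V, ∀ x₁ ∈ Metric.ball x₀ δ, ∀ x₂ ∈ Metric.ball x₀ δ,
      |g x₁ v - g x₂ v| ≤ K * ‖x₁ - x₂‖) ∧
    (∀ v₀ ∈ activeParams V g x₀,
      ∀ (x : ℕ → H) (v : ℕ → W) (x' : ℕ → H) (l : H),
        (∀ k, x k ∈ Metric.ball x₀ δ) → (∀ k, v k ∈ V) →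
        (∀ k, x' k ∈ limitingSubdiff (fun y => g y (v k)) (x k)) →
        Tendsto x atTop (𝓝 x₀) → Tendsto v atTop (𝓝 v₀) → Tendsto x' atTop (𝓝 l) →
        l ∈ limitingSubdiff (fun y => g y v₀) x₀)

/-! ### The scalar problem and its approximate solutions -/

/-- The robust feasible set `Ω`. -/
def feasibleSet {H J : Type*} {W : J → Type*} (S : Set H) (V : ∀ j, Set (W j))
    (g : ∀ j, H → W j → ℝ) : Set H :=
  {x ∈ S | ∀ j, ∀ v ∈ V j, g j x v ≤ 0}

/-- The relaxed feasible set `{x ∈ S : g_j(x) ≤ √θ for all j}`. -/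
def relaxedFeasibleSet {H J : Type*} {W : J → Type*} (S : Set H) (V : ∀ j, Set (W j))
    (g : ∀ j, H → W j → ℝ) (θ : ℝ) : Set H :=
  {x ∈ S | ∀ j, worstCase (V j) (g j) x ≤ √θ}

/-- The scalarized objective `φ = ∑ i, (f_i^L + f_i^U)`. -/
def scalarObjective {H I : Type*} [Fintype I] (fL fU : I → H → ℝ) (x : H) : ℝ :=
  ∑ i, (fL i x + fU i x)

/-- The total tolerance `θ = ∑ i, (ε_i^L + ε_i^U)`. -/
def totalTolerance {I : Type*} [Fintype I] (εL εU : I → ℝ) : ℝ :=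
  ∑ i, (εL i + εU i)

/-- `z` is an almost `θ`-solution of the problem of minimizing `φ` over `feasibleSet S V g`. -/
def IsAlmostSolution {H J : Type*} {W : J → Type*} (S : Set H) (V : ∀ j, Set (W j))
    (g : ∀ j, H → W j → ℝ) (φ : H → ℝ) (θ : ℝ) (z : H) : Prop :=
  z ∈ relaxedFeasibleSet S V g θ ∧ ∀ x ∈ feasibleSet S V g, φ z ≤ φ x + θ

/-- `z` is an almost `θ`-quasi solution of the problem of minimizing `φ` over
`feasibleSet S V g`. -/
def IsAlmostQuasiSolution {H J : Type*} [NormedAddCommGroup H] {W : J → Type*} (S : Set H)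
    (V : ∀ j, Set (W j)) (g : ∀ j, H → W j → ℝ) (φ : H → ℝ) (θ : ℝ) (z : H) : Prop :=
  z ∈ relaxedFeasibleSet S V g θ ∧ ∀ x ∈ feasibleSet S V g, φ z ≤ φ x + √θ * ‖x - z‖

/-- `z` is an almost regular `θ`-solution. -/
def IsAlmostRegularSolution {H J : Type*} [NormedAddCommGroup H] {W : J → Type*} (S : Set H)
    (V : ∀ j, Set (W j)) (g : ∀ j, H → W j → ℝ) (φ : H → ℝ) (θ : ℝ) (z : H) : Prop :=
  IsAlmostSolution S V g φ θ z ∧ IsAlmostQuasiSolution S V g φ θ z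

end

/-! The proof penalizes the uncertain constraints quadratically. On `S`, consider `P = φ + ρ ∑
max(G_j, 0)²`, with `G_j` the worst-case functions; `P` agrees with `φ` on the feasible set. A
variational principle (`exists_ekeland_point`), started at a `θ`-minimizer of `P`, gives a `z` that
is both `θ`-optimal and `√θ`-quasi-optimal for `P`. Both properties pass to `φ` over feasible points
because `φ ≤ P`. With `ρ` large enough, the bound on `P z` forces `G_j z ≤ √θ`.

The multipliers are the derivatives `2ρ max(G_j z, 0)` of the penalty, so their sign conditions are
automatic. Linearizing the squared positive part costs only a quadratic error (`sq_max_zero_le`), so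
`z` locally minimizes `φ + √θ‖· - z‖ + ∑ λ_j G_j` on `S` up to `C‖· - z‖²`, and no chain rule is
needed.

Two rules turn this into the inclusion, both obtained by passing to limits of proximal objects. The
sum rule (`exists_proxSubgradient_sum`) decouples the summands and the set by a quadratic penalty
and tolerates the quadratic error. The maximum rule (`mem_convexHull_of_tendsto_isProxSubgradient`)
separates a putative outside point by a direction; an approximate mean value inequality for a single
`g(·, v)`, with `v` active at a nearby point, then contradicts the separation. -/

/-- `ξ` is a proximal subgradient of `f` at `x`. -/
def IsProxSubgradient {E : Type*} [NormedAddCommGroup E] [InnerProductSpace ℝ E]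
    (f : E → ℝ) (x ξ : E) : Prop :=
  ∃ C : ℝ, ∀ᶠ u in 𝓝 x, f x + inner ℝ ξ (u - x) ≤ f u + C * ‖u - x‖ ^ 2

/-- `ν` is a proximal normal to `S` at `y`. -/
def IsProxNormal {E : Type*} [NormedAddCommGroup E] [InnerProductSpace ℝ E]
    (S : Set E) (y ν : E) : Prop :=
  ∃ C : ℝ, ∀ᶠ u in 𝓝[S] y, inner ℝ ν (u - y) ≤ C * ‖u - y‖ ^ 2

lemma tendsto_add_smul_nhdsGT {E : Type*} [NormedAddCommGroup E] [NormedSpace ℝ E] (x u : E) :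
    Tendsto (fun t : ℝ => x + t • u) (𝓝[>] 0) (𝓝 x) := by
  have : Tendsto (fun t : ℝ => x + t • u) (𝓝 0) (𝓝 (x + (0 : ℝ) • u)) :=
    Continuous.tendsto (by fun_prop) 0
  simpa using this.mono_left nhdsWithin_le_nhds

lemma tendsto_const_mul_nhdsGT (c : ℝ) : Tendsto (fun t : ℝ => c * t) (𝓝[>] 0) (𝓝 0) := by
  have : Tendsto (fun t : ℝ => c * t) (𝓝 0) (𝓝 (c * 0)) := Continuous.tendsto (by fun_prop) 0
  simpa using this.mono_left nhdsWithin_le_nhds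

lemma eventually_mul_norm_sq_le {E : Type*} [NormedAddCommGroup E] (x : E) (C : ℝ) {η : ℝ}
    (hη : 0 < η) :
    ∀ᶠ u in 𝓝 x, C * ‖u - x‖ ^ 2 ≤ η * ‖u - x‖ := by
  have h : Tendsto (fun u : E => C * ‖u - x‖) (𝓝 x) (𝓝 (C * ‖x - x‖)) :=
    Continuous.tendsto (by fun_prop) x
  rw [sub_self, norm_zero, mul_zero] at h
  filter_upwards [h.eventually_lt_const hη] with u hu
  nlinarith [norm_nonneg (u - x)]

/-! ### Proximal normals and subgradients, and the fuzzy sum rule. -/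

section ProximalCalculus

variable {E : Type*} [NormedAddCommGroup E] [InnerProductSpace ℝ E]

lemma IsProxNormal.mem_epsNormals {S : Set E} {y ν : E} (h : IsProxNormal S y ν) {ε : ℝ}
    (hε : 0 ≤ ε) : ν ∈ epsNormals ε y S := by
  obtain ⟨C, hC⟩ := h
  intro η hη
  filter_upwards [hC, (eventually_mul_norm_sq_le y C hη).filter_mono nhdsWithin_le_nhds]
    with u h1 h2
  nlinarith [norm_nonneg (u - y)]

lemma tendsto_one_div_nat_nhdsGT :
    Tendsto (fun k : ℕ => 1 / ((k : ℝ) + 1)) atTop (𝓝[>] 0) :=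
  tendsto_nhdsWithin_iff.2 ⟨tendsto_one_div_add_atTop_nhds_zero_nat,
    Eventually.of_forall fun _ => mem_Ioi.2 Nat.one_div_pos_of_nat⟩

/-- A quadratic error is `o(‖u - y‖)`, so proximal normals are `ε`-normals even for `ε = 0`; the
sequence `1 / (k + 1)` only meets the demand that the tolerances be positive. -/
lemma mem_limitingNormalCone_of_prox {S : Set E} {z ν : E} {y w : ℕ → E} (hy : ∀ k, y k ∈ S)
    (hyz : Tendsto y atTop (𝓝 z)) (hw : Tendsto w atTop (𝓝 ν))
    (h : ∀ k, IsProxNormal S (y k) (w k)) : ν ∈ limitingNormalCone z S :=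
  ⟨y, fun k => 1 / ((k : ℝ) + 1), w, hy, hyz, tendsto_one_div_nat_nhdsGT, hw,
    fun k => (h k).mem_epsNormals Nat.one_div_pos_of_nat.le⟩

lemma IsProxSubgradient.isProxNormal_epigraph {f : E → ℝ} {x ξ : E} (h : IsProxSubgradient f x ξ) :
    IsProxNormal (epigraph f) (WithLp.toLp 2 (x, f x)) (WithLp.toLp 2 (ξ, (-1 : ℝ))) := by
  obtain ⟨C, hC⟩ := h
  -- The squared norm in the product also contains the height difference, which a negative constant
  -- would put on the wrong side.
  refine ⟨|C|, ?_⟩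
  have hfst : Tendsto (fun q : WithLp 2 (E × ℝ) => q.fst)
      (𝓝[epigraph f] (WithLp.toLp 2 (x, f x))) (𝓝 x) := by
    have : Continuous (fun q : WithLp 2 (E × ℝ) => q.fst) := by fun_prop
    exact (this.tendsto (WithLp.toLp 2 (x, f x))).mono_left nhdsWithin_le_nhds
  filter_upwards [hfst.eventually hC, self_mem_nhdsWithin] with q hq hq'
  have hq'' : f q.fst ≤ q.snd := hq'
  have hn : ‖q - WithLp.toLp 2 (x, f x)‖ ^ 2 = ‖q.fst - x‖ ^ 2 + ‖q.snd - f x‖ ^ 2 := by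
    rw [WithLp.prod_norm_sq_eq_of_L2]; simp
  have hi : inner ℝ (WithLp.toLp 2 (ξ, (-1 : ℝ))) (q - WithLp.toLp 2 (x, f x))
      = inner ℝ ξ (q.fst - x) - (q.snd - f x) := by
    rw [WithLp.prod_inner_apply]; simp; ring
  rw [hn, hi]
  nlinarith [le_abs_self C, abs_nonneg C, sq_nonneg ‖q.fst - x‖, sq_nonneg ‖q.snd - f x‖,
    mul_nonneg (abs_nonneg C) (sq_nonneg ‖q.snd - f x‖),
    mul_le_mul_of_nonneg_right (le_abs_self C) (sq_nonneg ‖q.fst - x‖)]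

/-- Continuity at `z` is what makes the graph points `(x k, f (x k))` converge to `(z, f z)`. -/
lemma mem_limitingSubdiff_of_prox {f : E → ℝ} {z ξ : E} {x w : ℕ → E} (hf : ContinuousAt f z)
    (hxz : Tendsto x atTop (𝓝 z)) (hw : Tendsto w atTop (𝓝 ξ))
    (h : ∀ k, IsProxSubgradient f (x k) (w k)) : ξ ∈ limitingSubdiff f z := by
  have hc : ∀ {a : ℕ → E} {b : ℕ → ℝ} {a₀ : E} {b₀ : ℝ}, Tendsto a atTop (𝓝 a₀) →
      Tendsto b atTop (𝓝 b₀) → Tendsto (fun k => WithLp.toLp 2 (a k, b k)) atTop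
        (𝓝 (WithLp.toLp 2 (a₀, b₀))) := fun ha hb =>
    ((WithLp.prod_continuous_toLp 2 E ℝ).tendsto _).comp (ha.prodMk_nhds hb)
  exact mem_limitingNormalCone_of_prox (y := fun k => WithLp.toLp 2 (x k, f (x k)))
    (fun k => le_refl (f (x k))) (hc hxz (hf.tendsto.comp hxz)) (hc hw tendsto_const_nhds)
    fun k => (h k).isProxNormal_epigraph

lemma IsProxSubgradient.mem_limitingSubdiff {f : E → ℝ} {x ξ : E} (h : IsProxSubgradient f x ξ)
    (hf : ContinuousAt f x) : ξ ∈ limitingSubdiff f x :=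
  mem_limitingSubdiff_of_prox hf tendsto_const_nhds tendsto_const_nhds fun _ => h

/-- Directional form of the proximal subgradient inequality. -/
lemma IsProxSubgradient.eventually_dir {f : E → ℝ} {x ξ : E} (h : IsProxSubgradient f x ξ)
    (u : E) {ε : ℝ} (hε : 0 < ε) :
    ∀ᶠ t : ℝ in 𝓝[>] 0, t * (inner ℝ ξ u - ε) ≤ f (x + t • u) - f x := by
  obtain ⟨C, hC⟩ := h
  have h1 := tendsto_add_smul_nhdsGT x u
  have h2 := tendsto_const_mul_nhdsGT (C * ‖u‖ ^ 2)
  filter_upwards [h1.eventually hC, h2.eventually_lt_const hε, self_mem_nhdsWithin]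
    with t ht1 ht2 ht3
  have ht : 0 < t := ht3
  rw [add_sub_cancel_left, inner_smul_right, norm_smul, Real.norm_eq_abs, abs_of_pos ht] at ht1
  nlinarith

/-- Test the subgradient inequality in the direction `ξ` itself. The bound supplies compactness
whenever subgradients have to converge along a subsequence. -/
lemma IsProxSubgradient.norm_le {f : E → ℝ} {x ξ : E} (h : IsProxSubgradient f x ξ) {K : ℝ}
    (hK : 0 ≤ K) (hf : ∀ᶠ u in 𝓝 x, |f u - f x| ≤ K * ‖u - x‖) : ‖ξ‖ ≤ K := by
  have h1 := tendsto_add_smul_nhdsGT x ξ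
  have key : ‖ξ‖ ^ 2 ≤ K * ‖ξ‖ := by
    refine le_of_forall_pos_le_add fun ε hε => ?_
    obtain ⟨t, ht1, ht2, ht3⟩ :=
      ((h.eventually_dir ξ hε).and ((h1.eventually hf).and self_mem_nhdsWithin)).exists
    have ht : 0 < t := ht3
    rw [add_sub_cancel_left, norm_smul, Real.norm_eq_abs, abs_of_pos ht] at ht2
    rw [real_inner_self_eq_norm_sq] at ht1
    have := le_of_abs_le ht2
    have : t * (‖ξ‖ ^ 2 - ε) ≤ t * (K * ‖ξ‖) := by linarith
    linarith [le_of_mul_le_mul_left this ht]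
  rcases (norm_nonneg ξ).eq_or_lt with h0 | h0
  · rw [← h0]; exact hK
  · nlinarith

lemma IsProxSubgradient.of_add_inner {f : E → ℝ} {l x ξ : E}
    (h : IsProxSubgradient (fun y => f y + inner ℝ l y) x ξ) :
    IsProxSubgradient f x (ξ - l) := by
  obtain ⟨C, hC⟩ := h
  refine ⟨C, hC.mono fun u hu => ?_⟩
  rw [inner_sub_left, inner_sub_right l]
  linarith

lemma IsProxSubgradient.of_const_mul {f : E → ℝ} {c : ℝ} {x ξ : E} (hc : 0 < c)
    (h : IsProxSubgradient (fun y => c * f y) x ξ) : IsProxSubgradient f x (c⁻¹ • ξ) := by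
  obtain ⟨C, hC⟩ := h
  refine ⟨c⁻¹ * C, hC.mono fun u hu => ?_⟩
  have := mul_le_mul_of_nonneg_left hu (inv_pos.2 hc).le
  rw [inner_smul_left]
  simp only [mul_add, inv_mul_cancel_left₀ hc.ne'] at this
  simpa [mul_assoc] using this

/-- Approximate sum rule: a minimizer of a sum of Lipschitz functions over a closed set, up to a
quadratic term, is the limit of points at which proximal subgradients and a proximal normal almost
add up to zero. -/
theorem exists_proxSubgradient_sum [FiniteDimensional ℝ E] {ι : Type*} [Fintype ι]
    {F : ι → E → ℝ} {S : Set E} (hS : IsClosed S) {z : E} (hz : z ∈ S) {r : ℝ} (hr : 0 < r)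
    {L : ℝ} (hL0 : 0 ≤ L)
    (hL : ∀ i, ∀ x ∈ Metric.closedBall z r, ∀ y ∈ Metric.closedBall z r,
      |F i x - F i y| ≤ L * ‖x - y‖)
    {C : ℝ} (hC : 0 ≤ C)
    (hmin : ∀ x ∈ S ∩ Metric.closedBall z r, ∑ i, F i z ≤ ∑ i, F i x + C * ‖x - z‖ ^ 2)
    {ε : ℝ} (hε : 0 < ε) :
    ∃ (x ξ : ι → E) (y ν : E), (∀ i, ‖x i - z‖ < ε) ∧
      (∀ i, IsProxSubgradient (F i) (x i) (ξ i)) ∧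
      y ∈ S ∧ ‖y - z‖ < ε ∧ IsProxNormal S y ν ∧ ‖∑ i, ξ i + ν‖ < ε := by
  classical
  set N : ℝ := (Fintype.card ι : ℝ) with hN
  have hN0 : 0 ≤ N := Nat.cast_nonneg _
  -- The constants are chosen backwards. `a` will bound `‖y - z‖`: it makes the residual `2(C + 1)‖y
  -- - z‖` less than `ε` and keeps all points inside the ball. `s` will bound each `‖x i - y‖`, and
  -- the penalty weight `k` is taken large enough to enforce this.
  obtain ⟨a, ha0, haε, har⟩ : ∃ a : ℝ, 0 < a ∧ a * (2 * (C + 1)) < ε ∧ a * 2 < r := by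
    refine ⟨min (ε / (4 * (C + 1))) (r / 4), by positivity, ?_, ?_⟩
    · have := min_le_left (ε / (4 * (C + 1))) (r / 4)
      have h2 : ε / (4 * (C + 1)) * (2 * (C + 1)) = ε / 2 := by field_simp; ring
      nlinarith
    · linarith [min_le_right (ε / (4 * (C + 1))) (r / 4)]
  obtain ⟨s, hs0, hsa, hsL⟩ : ∃ s : ℝ, 0 < s ∧ s ≤ a ∧ L * (N * s) < a ^ 2 := by
    refine ⟨min a (a ^ 2 / (2 * (L * N + 1))), by positivity, min_le_left _ _, ?_⟩
    have h1 := min_le_right a (a ^ 2 / (2 * (L * N + 1)))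
    have h2 : a ^ 2 / (2 * (L * N + 1)) * (L * N + 1) = a ^ 2 / 2 := by field_simp
    nlinarith [mul_nonneg hL0 hN0, mul_le_mul_of_nonneg_left h1 (mul_nonneg hL0 hN0),
      sq_pos_of_pos ha0, (by positivity : 0 < a ^ 2 / (2 * (L * N + 1)))]
  obtain ⟨k, hk0, hk⟩ : ∃ k : ℝ, 0 < k ∧ L * (N * (2 * r)) < k * s ^ 2 := by
    refine ⟨(L * (N * (2 * r)) + 1) / s ^ 2, by positivity, ?_⟩
    rw [div_mul_cancel₀ _ (by positivity)]; linarith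
  set B := Metric.closedBall z r with hB
  have hzB : z ∈ B := Metric.mem_closedBall_self hr.le
  have hFc : ∀ i, ContinuousOn (F i) B := fun i => by
    refine (LipschitzOnWith.of_dist_le_mul (K := ⟨L, hL0⟩) fun x hx y hy => ?_).continuousOn
    rw [Real.dist_eq, dist_eq_norm]; exact hL i x hx y hy
  -- Each summand gets its own variable and the set gets `y`. Of the weight `C + 1`, the part `C`
  -- absorbs the quadratic error in `hmin`; the extra `1` leaves control of `‖y - z‖²` in `hbase`.
  let Φ : (ι → E) × E → ℝ := fun q =>
    ∑ i, F i (q.1 i) + k * ∑ i, ‖q.1 i - q.2‖ ^ 2 + (C + 1) * ‖q.2 - z‖ ^ 2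
  have hK : IsCompact ((univ.pi fun _ : ι => B) ×ˢ (S ∩ B)) :=
    (isCompact_univ_pi fun _ => isCompact_closedBall z r).prod
      ((isCompact_closedBall z r).inter_left hS)
  have hΦ : ContinuousOn Φ ((univ.pi fun _ : ι => B) ×ˢ (S ∩ B)) := by
    refine ContinuousOn.add (ContinuousOn.add ?_ ?_) ?_
    · refine continuousOn_finsetSum _ fun i _ => (hFc i).comp (by fun_prop) ?_
      intro q hq
      exact hq.1 i (mem_univ i)
    · fun_prop
    · fun_prop
  obtain ⟨⟨x, y⟩, ⟨hxB, hyS, hyB⟩, hmin'⟩ :=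
    hK.exists_isMinOn ⟨(fun _ => z, z), fun _ _ => hzB, hz, hzB⟩ hΦ
  replace hxB : ∀ i, x i ∈ B := fun i => hxB i (mem_univ i)
  have hmin2 : ∀ x' y', (∀ i, x' i ∈ B) → y' ∈ S → y' ∈ B → Φ (x, y) ≤ Φ (x', y') :=
    fun x' y' h1 h2 h3 => hmin' ⟨fun i _ => h1 i, h2, h3⟩
  have hbase : k * ∑ i, ‖x i - y‖ ^ 2 + ‖y - z‖ ^ 2 ≤ L * ∑ i, ‖x i - y‖ := by
    have h1 := hmin2 (fun _ => z) z (fun _ => hzB) hz hzB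
    have h2 := hmin y ⟨hyS, hyB⟩
    have h3 : ∑ i, F i y ≤ ∑ i, F i (x i) + L * ∑ i, ‖x i - y‖ := by
      rw [Finset.mul_sum, ← Finset.sum_add_distrib]
      exact Finset.sum_le_sum fun i _ => by
        linarith [neg_abs_le (F i (x i) - F i y), hL i _ (hxB i) _ hyB]
    simp only [Φ, sub_self, norm_zero] at h1
    norm_num at h1
    nlinarith
  have hd2r : ∀ i, ‖x i - y‖ ≤ 2 * r := fun i => by
    have h1 := hxB i
    have h2 := hyB
    rw [hB, Metric.mem_closedBall] at h1 h2
    rw [← dist_eq_norm]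
    linarith [dist_triangle_right (x i) y z]
  have hds : ∀ i, ‖x i - y‖ < s := fun i => by
    have h1 : ∑ i, ‖x i - y‖ ≤ N * (2 * r) := by
      simpa [hN] using Finset.sum_le_sum fun i (_ : i ∈ Finset.univ) => hd2r i
    have h2 : ‖x i - y‖ ^ 2 ≤ ∑ i, ‖x i - y‖ ^ 2 :=
      Finset.single_le_sum (f := fun i => ‖x i - y‖ ^ 2) (fun _ _ => sq_nonneg _)
        (Finset.mem_univ i)
    have h3 : k * ‖x i - y‖ ^ 2 < k * s ^ 2 := by
      nlinarith [mul_le_mul_of_nonneg_left h1 hL0, mul_le_mul_of_nonneg_left h2 hk0.le,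
        sq_nonneg ‖y - z‖]
    exact lt_of_pow_lt_pow_left₀ 2 hs0.le (lt_of_mul_lt_mul_left h3 hk0.le)
  have hya : ‖y - z‖ < a := by
    have h1 : ∑ i, ‖x i - y‖ ≤ N * s := by
      simpa [hN] using Finset.sum_le_sum fun i (_ : i ∈ Finset.univ) => (hds i).le
    have h2 : 0 ≤ k * ∑ i, ‖x i - y‖ ^ 2 :=
      mul_nonneg hk0.le (Finset.sum_nonneg fun _ _ => sq_nonneg _)
    refine lt_of_pow_lt_pow_left₀ 2 ha0.le ?_
    nlinarith [mul_le_mul_of_nonneg_left h1 hL0]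
  have hxa : ∀ i, ‖x i - z‖ < a * 2 := fun i => by
    have := norm_sub_le_norm_sub_add_norm_sub (x i) y z
    linarith [hds i]
  have ha2ε : a * 2 < ε := by nlinarith
  have hball : ∀ w, ‖w - z‖ < r → ∀ᶠ u in 𝓝 w, u ∈ B := fun w hw =>
    mem_of_superset (Metric.isOpen_ball.mem_nhds (by rwa [Metric.mem_ball, dist_eq_norm]))
      Metric.ball_subset_closedBall
  -- Varying one block of the minimizer at a time reads these vectors off the quadratic terms. The
  -- coupling contributions cancel in the total, leaving only the gradient of `(C + 1)‖y - z‖²` up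
  -- to sign.
  refine ⟨x, fun i => -((2 * k) • (x i - y)), y,
    ∑ i, (2 * k) • (x i - y) - (2 * (C + 1)) • (y - z), fun i => (hxa i).trans ha2ε, ?_, hyS,
    by linarith, ?_, ?_⟩
  · refine fun i => ⟨k, (hball (x i) (by linarith [hxa i])).mono fun u hu => ?_⟩
    have h1 := hmin2 (Function.update x i u) y (fun j => by
      by_cases hj : j = i
      · subst hj; simpa using hu
      · simpa [hj] using hxB j) hyS hyB
    have h2 : ∀ f : ι → E → ℝ, ∑ j, f j (Function.update x i u j)
        = ∑ j, f j (x j) + (f i u - f i (x i)) := fun f => by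
      rw [← Finset.add_sum_erase _ _ (Finset.mem_univ i),
        ← Finset.add_sum_erase (a := i) _ (fun j => f j (x j)) (Finset.mem_univ i)]
      rw [Finset.sum_congr rfl fun j hj => by
        rw [Function.update_of_ne (Finset.ne_of_mem_erase hj)]]
      rw [Function.update_self]; ring
    have h3 := h2 F
    have h4 := h2 (fun _ w => ‖w - y‖ ^ 2)
    simp only [Φ] at h1
    rw [h3, h4] at h1
    have h5 : ‖u - y‖ ^ 2 = ‖x i - y‖ ^ 2 + 2 * inner ℝ (x i - y) (u - x i) + ‖u - x i‖ ^ 2 := by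
      rw [← norm_add_sq_real]; congr 2; abel
    rw [h5] at h1
    rw [inner_neg_left, inner_smul_left]
    simp only [conj_trivial]
    nlinarith
  · refine ⟨k * N + (C + 1), ?_⟩
    filter_upwards [self_mem_nhdsWithin,
      (hball y (by linarith)).filter_mono nhdsWithin_le_nhds] with u huS huB
    have h1 := hmin2 x u hxB huS huB
    have h2 : ∀ w : E, ‖w - u‖ ^ 2 = ‖w - y‖ ^ 2 - 2 * inner ℝ (w - y) (u - y) + ‖u - y‖ ^ 2 :=
      fun w => by rw [← norm_sub_sq_real]; congr 2; abel
    have h3 : ‖u - z‖ ^ 2 = ‖y - z‖ ^ 2 + 2 * inner ℝ (y - z) (u - y) + ‖u - y‖ ^ 2 := by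
      rw [← norm_add_sq_real]; congr 2; abel
    simp only [Φ, h2, h3, Finset.sum_add_distrib, Finset.sum_sub_distrib, Finset.sum_const,
      Finset.card_univ, nsmul_eq_mul, ← Finset.mul_sum] at h1
    rw [inner_sub_left, sum_inner]
    simp only [inner_smul_left, conj_trivial, ← Finset.mul_sum]
    nlinarith
  · have : ∑ i, -((2 * k) • (x i - y)) + (∑ i, (2 * k) • (x i - y) - (2 * (C + 1)) • (y - z))
        = -((2 * (C + 1)) • (y - z)) := by
      rw [Finset.sum_neg_distrib]; abel
    rw [this, norm_neg, norm_smul, Real.norm_eq_abs, abs_of_pos (by positivity)]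
    nlinarith

end ProximalCalculus

/-! ### Compactness of convex hulls. -/

/-- In finite dimension the convex hull of a compact set is compact. -/
theorem IsCompact.convexHull_of_finiteDimensional {E : Type*} [NormedAddCommGroup E]
    [NormedSpace ℝ E] [FiniteDimensional ℝ E] {K : Set E} (hK : IsCompact K) :
    IsCompact (convexHull ℝ K) := by
  let T : ∀ m : ℕ, (Fin m → ℝ) × (Fin m → E) → E := fun m q => ∑ i, q.1 i • q.2 i
  let A : ∀ m : ℕ, Set ((Fin m → ℝ) × (Fin m → E)) := fun m =>
    stdSimplex ℝ (Fin m) ×ˢ univ.pi fun _ => K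
  have hA : ∀ m, IsCompact (T m '' A m) := fun m =>
    ((isCompact_stdSimplex ℝ (Fin m)).prod (isCompact_univ_pi fun _ => hK)).image (by fun_prop)
  -- Carathéodory: at most `finrank + 1` points are needed, so the hull is a finite union of
  -- continuous images of compact sets.
  have heq : convexHull ℝ K = ⋃ m ∈ Finset.range (Module.finrank ℝ E + 2), T m '' A m := by
    refine Subset.antisymm (fun x hx => ?_) (iUnion₂_subset fun m _ => ?_)
    · obtain ⟨ι, hι, z, w, hz, hind, hw, hw1, rfl⟩ := eq_pos_convex_span_of_mem_convexHull hx
      let e := Fintype.equivFin ι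
      have hcard : Fintype.card ι ≤ Module.finrank ℝ E + 1 :=
        hind.card_le_finrank_succ.trans (Nat.succ_le_succ (Submodule.finrank_le _))
      refine mem_iUnion₂.2 ⟨Fintype.card ι, Finset.mem_range.2 (by omega),
        ⟨⟨fun i => w (e.symm i), fun i => z (e.symm i)⟩, ⟨⟨fun i => (hw _).le, ?_⟩, ?_⟩, ?_⟩⟩
      · rw [← hw1]; exact e.symm.sum_comp w
      · exact fun i _ => hz (mem_range_self _)
      · exact e.symm.sum_comp fun i => w i • z i
    · rintro _ ⟨⟨w, z⟩, ⟨hw, hz⟩, rfl⟩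
      exact (convex_convexHull ℝ K).sum_mem (fun i _ => hw.1 i) hw.2
        fun i _ => subset_convexHull ℝ K (hz i (mem_univ i))
  rw [heq]
  exact (Finset.range _).isCompact_biUnion fun m _ => hA m

/-! ### Existence of proximal subgradients and the mean value inequality. -/

section MeanValue

variable {E : Type*} [NormedAddCommGroup E] [InnerProductSpace ℝ E] [FiniteDimensional ℝ E]

lemma eventually_abs_sub_le_of_lipschitz {E : Type*} [NormedAddCommGroup E] {f : E → ℝ} {x₀ x : E}
    {δ K : ℝ}
    (hf : ∀ x ∈ Metric.ball x₀ δ, ∀ y ∈ Metric.ball x₀ δ, |f x - f y| ≤ K * ‖x - y‖)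
    (hx : x ∈ Metric.ball x₀ δ) : ∀ᶠ u in 𝓝 x, |f u - f x| ≤ K * ‖u - x‖ :=
  mem_of_superset (Metric.isOpen_ball.mem_nhds hx) fun u hu => hf u hu x hx

lemma continuousAt_of_lipschitz {E : Type*} [NormedAddCommGroup E] {f : E → ℝ} {x₀ x : E} {δ K : ℝ}
    (hf : ∀ x ∈ Metric.ball x₀ δ, ∀ y ∈ Metric.ball x₀ δ, |f x - f y| ≤ K * ‖x - y‖)
    (hx : x ∈ Metric.ball x₀ δ) : ContinuousAt f x :=
  continuousAt_of_locally_lipschitz (r := δ - dist x x₀) (by simpa using hx) K fun y hy => by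
    rw [Real.dist_eq, dist_eq_norm]
    refine hf y ?_ x hx
    have := dist_triangle y x x₀
    rw [Metric.mem_ball]; linarith

/-- Proximal subgradients of a Lipschitz function exist at points arbitrarily close to a given
point. -/
lemma exists_isProxSubgradient_near {f : E → ℝ} {x₀ z : E} {δ K : ℝ} (hK : 0 ≤ K)
    (hf : ∀ x ∈ Metric.ball x₀ δ, ∀ y ∈ Metric.ball x₀ δ, |f x - f y| ≤ K * ‖x - y‖)
    (hz : z ∈ Metric.ball x₀ δ) {ε : ℝ} (hε : 0 < ε) :
    ∃ y ξ, ‖y - z‖ < ε ∧ IsProxSubgradient f y ξ := by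
  obtain ⟨r, hr, hrs⟩ := Metric.nhds_basis_closedBall.mem_iff.1 (Metric.isOpen_ball.mem_nhds hz)
  -- Over the singleton `{z}` the minimality hypothesis is trivial, so the sum rule yields pure
  -- existence.
  obtain ⟨x, ξ, -, -, hx, hξ, -⟩ := exists_proxSubgradient_sum (ι := Unit) (F := fun _ => f)
    (S := {z}) isClosed_singleton rfl hr hK (fun _ x hx y hy => hf x (hrs hx) y (hrs hy)) le_rfl
    (by rintro x ⟨rfl, -⟩; simp) hε
  exact ⟨x (), ξ (), hx (), hξ ()⟩

/-- Approximate mean value inequality. -/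
theorem exists_isProxSubgradient_mean_value {f : E → ℝ} {x₀ a b : E} {δ K : ℝ} (hK : 0 ≤ K)
    (hf : ∀ x ∈ Metric.ball x₀ δ, ∀ y ∈ Metric.ball x₀ δ, |f x - f y| ≤ K * ‖x - y‖)
    (ha : a ∈ Metric.ball x₀ δ) (hb : b ∈ Metric.ball x₀ δ) (hab : a ≠ b) {ε : ℝ} (hε : 0 < ε) :
    ∃ y ξ, y ∈ Metric.ball x₀ δ ∧ ‖y - a‖ < ‖b - a‖ + ε ∧ IsProxSubgradient f y ξ ∧
      f b - f a - ε ≤ inner ℝ ξ (b - a) := by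
  set h := b - a with hh
  have hh0 : 0 < ‖h‖ := norm_pos_iff.2 (sub_ne_zero.2 hab.symm)
  -- The tilt gives `F b - F a = ε / 2 > 0`, so a minimizer on the segment is not `b` and `h`
  -- remains a feasible direction there.
  set l : E := (-(f b - f a - ε / 2) / ‖h‖ ^ 2) • h with hl
  have hlh : inner ℝ l h = -(f b - f a - ε / 2) := by
    rw [hl, inner_smul_left, real_inner_self_eq_norm_sq]
    simp only [conj_trivial]
    field_simp
  have hseg : segment ℝ a b ⊆ Metric.ball x₀ δ := (convex_ball x₀ δ).segment_subset ha hb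
  set F : E → ℝ := fun y => f y + inner ℝ l y with hF
  have hFL : ∀ x ∈ Metric.ball x₀ δ, ∀ y ∈ Metric.ball x₀ δ,
      |F x - F y| ≤ (K + ‖l‖) * ‖x - y‖ := fun x hx y hy => by
    have h1 := abs_real_inner_le_norm l (x - y)
    have h2 : F x - F y = (f x - f y) + inner ℝ l (x - y) := by
      simp only [hF]; rw [inner_sub_right]; ring
    rw [h2, add_mul]
    exact (abs_add_le _ _).trans (add_le_add (hf x hx y hy) h1)
  have hcomp : IsCompact (segment ℝ a b) := by
    rw [segment_eq_image']
    exact isCompact_Icc.image (by fun_prop)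
  obtain ⟨z, hzS, hzmin⟩ := hcomp.exists_isMinOn ⟨a, left_mem_segment ℝ a b⟩
    (f := F) fun x hx => (continuousAt_of_lipschitz hFL (hseg hx)).continuousWithinAt
  have hzb : z ≠ b := by
    rintro rfl
    have h1 : F z ≤ F a := hzmin (left_mem_segment ℝ a z)
    have h2 : F z - F a = ε / 2 := by
      have : F z - F a = (f z - f a) + inner ℝ l h := by
        simp only [hF, hh]; rw [inner_sub_right]; ring
      rw [this, hlh]; ring
    linarith
  have hzb' : 0 < ‖b - z‖ := norm_pos_iff.2 (sub_ne_zero.2 hzb.symm)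
  obtain ⟨r, hr, hrs⟩ :=
    Metric.nhds_basis_closedBall.mem_iff.1 (Metric.isOpen_ball.mem_nhds (hseg hzS))
  -- In order: stay in the Lipschitz ball, keep the normal's base point away from `b`, locate `x`
  -- near `z`, and make the residual paired with `h` at most `ε / 2`.
  have hη : 0 < min (min r ‖b - z‖) (min ε (ε / (2 * ‖h‖))) :=
    lt_min (lt_min hr hzb') (lt_min hε (by positivity))
  obtain ⟨x, ξ, y, ν, hx, hξ, hyS, hyz, hν, hsum⟩ := exists_proxSubgradient_sum (ι := Unit)
    (F := fun _ => F) hcomp.isClosed hzS hr (by positivity)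
    (fun _ x hx y hy => hFL x (hrs hx) y (hrs hy)) le_rfl
    (fun x hx => by simpa using hzmin hx.1) hη
  rw [lt_min_iff, lt_min_iff, lt_min_iff] at hyz hsum
  have hx1 := hx ()
  rw [lt_min_iff, lt_min_iff, lt_min_iff] at hx1
  -- From a point of the segment other than `b` one can move a little along `h`; the normal
  -- inequality is tested on these points.
  have hνh : inner ℝ ν h ≤ 0 := by
    obtain ⟨C, hC⟩ := hν
    rw [segment_eq_image'] at hyS
    obtain ⟨s, ⟨hs0, hs1⟩, rfl⟩ := hyS
    have hs1' : s < 1 := by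
      refine lt_of_le_of_ne hs1 ?_
      rintro rfl
      have h1 := hyz.1.2
      simp at h1
    have h1 : Tendsto (fun t : ℝ => a + s • h + t • h) (𝓝[>] 0)
        (𝓝[segment ℝ a b] (a + s • h)) := by
      refine tendsto_nhdsWithin_iff.2 ⟨?_, ?_⟩
      · exact tendsto_add_smul_nhdsGT (a + s • h) h
      · filter_upwards [Ioo_mem_nhdsGT (sub_pos.2 hs1')] with t ht
        rw [segment_eq_image']
        refine ⟨s + t, ⟨by linarith [ht.1], by linarith [ht.2]⟩, ?_⟩
        simp only [add_smul, ← hh, add_assoc]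
    refine le_of_forall_pos_le_add fun e he => ?_
    have h2 := tendsto_const_mul_nhdsGT (C * ‖h‖ ^ 2)
    obtain ⟨t, ht1, ht2, ht3⟩ :=
      ((h1.eventually hC).and ((h2.eventually_lt_const he).and self_mem_nhdsWithin)).exists
    have ht : 0 < t := ht3
    rw [← hh, add_sub_cancel_left, inner_smul_right, norm_smul, Real.norm_eq_abs,
      abs_of_pos ht] at ht1
    nlinarith
  refine ⟨x (), ξ () - l, hrs ?_, ?_, (hξ ()).of_add_inner, ?_⟩
  · rw [Metric.mem_closedBall, dist_eq_norm]; exact hx1.1.1.le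
  · have h1 : ‖z - a‖ ≤ ‖h‖ := by
      rw [segment_eq_image'] at hzS
      obtain ⟨s, ⟨hs0, hs1⟩, rfl⟩ := hzS
      rw [add_sub_cancel_left, norm_smul, Real.norm_eq_abs, abs_of_nonneg hs0]
      nlinarith
    have := norm_sub_le_norm_sub_add_norm_sub (x ()) z a
    linarith [hx1.2.1]
  · have h1 := abs_real_inner_le_norm (∑ i, ξ i + ν) h
    have h2 : ‖∑ i, ξ i + ν‖ * ‖h‖ ≤ ε / 2 := by
      have := mul_le_mul_of_nonneg_right hsum.2.2.le hh0.le
      have h3 : ε / (2 * ‖h‖) * ‖h‖ = ε / 2 := by field_simp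
      linarith
    have h3 := neg_abs_le (inner ℝ (∑ i, ξ i + ν) h)
    rw [inner_add_left] at h1 h3
    simp only [Finset.univ_unique, Finset.sum_singleton, PUnit.default_eq_unit] at h1 h2 h3
    rw [inner_sub_left, hlh]
    linarith

end MeanValue

/-! ### Elementary properties of worst-case functions. -/

section WorstCase

variable {H W : Type*} {V : Set W} {g : H → W → ℝ}

lemma exists_activeParams [TopologicalSpace W] (hne : V.Nonempty) (hc : IsCompact V) {x : H}
    (hu : UpperSemicontinuousOn (g x) V) : (activeParams V g x).Nonempty := by
  obtain ⟨v, hv, hmax⟩ := hu.exists_isMaxOn hne hc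
  refine ⟨v, hv, le_antisymm (le_csSup (hu.bddAbove_of_isCompact hc) (mem_image_of_mem _ hv)) ?_⟩
  exact csSup_le (hne.image _) (by rintro _ ⟨w, hw, rfl⟩; exact hmax hw)

lemma le_worstCase [TopologicalSpace W] (hc : IsCompact V) {x : H}
    (hu : UpperSemicontinuousOn (g x) V) {v : W} (hv : v ∈ V) : g x v ≤ worstCase V g x :=
  le_csSup (hu.bddAbove_of_isCompact hc) (mem_image_of_mem _ hv)

lemma worstCase_lipschitz [NormedAddCommGroup H] [TopologicalSpace W] (hne : V.Nonempty)
    (hc : IsCompact V) {x₀ : H} {δ K : ℝ}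
    (hu : ∀ x ∈ Metric.ball x₀ δ, UpperSemicontinuousOn (g x) V)
    (hL : ∀ v ∈ V, ∀ x ∈ Metric.ball x₀ δ, ∀ y ∈ Metric.ball x₀ δ,
      |g x v - g y v| ≤ K * ‖x - y‖) :
    ∀ x ∈ Metric.ball x₀ δ, ∀ y ∈ Metric.ball x₀ δ,
      |worstCase V g x - worstCase V g y| ≤ K * ‖x - y‖ := by
  have key : ∀ x ∈ Metric.ball x₀ δ, ∀ y ∈ Metric.ball x₀ δ,
      worstCase V g x - worstCase V g y ≤ K * ‖x - y‖ := fun x hx y hy => by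
    obtain ⟨v, hv, hvx⟩ := exists_activeParams hne hc (hu x hx)
    have h1 := le_worstCase hc (hu y hy) hv
    linarith [le_of_abs_le (hL v hv x hx y hy)]
  refine fun x hx y hy => abs_le.2 ⟨?_, key x hx y hy⟩
  have := key y hy x hx
  rw [norm_sub_rev] at this
  linarith

/-- A limit of parameters that are active up to a vanishing error is active. -/
lemma mem_activeParams_of_tendsto [TopologicalSpace W] (hc : IsCompact V) {x : H}
    (hu : UpperSemicontinuousOn (g x) V) {v : ℕ → W} {v₀ : W} (hv : ∀ k, v k ∈ V) (hv₀ : v₀ ∈ V)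
    (hlim : Tendsto v atTop (𝓝 v₀)) {e : ℕ → ℝ} (he : Tendsto e atTop (𝓝 0))
    (hle : ∀ k, worstCase V g x - e k ≤ g x (v k)) : v₀ ∈ activeParams V g x := by
  refine ⟨hv₀, le_antisymm (le_worstCase hc hu hv₀) ?_⟩
  by_contra! hlt
  obtain ⟨c, hc1, hc2⟩ := exists_between hlt
  have h1 : ∀ᶠ k in atTop, g x (v k) < c :=
    (tendsto_nhdsWithin_iff.2 ⟨hlim, Eventually.of_forall hv⟩).eventually
      (upperSemicontinuousWithinAt_iff.1 (upperSemicontinuousOn_iff.1 hu v₀ hv₀) c hc1)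
  obtain ⟨k, hk1, hk2⟩ := (h1.and (he.eventually_lt_const (sub_pos.2 hc2))).exists
  linarith [hle k]

end WorstCase

/-! ### Subgradients of a maximum over a compact parameter set. -/

section SupRule

variable {E : Type*} [NormedAddCommGroup E] [InnerProductSpace ℝ E]
  {W : Type*} [MetricSpace W] {V : Set W} {g : E → W → ℝ}

/-- The common Lipschitz and semicontinuity data contained in `ConstraintRegularAt`, with a
nonnegative rank. -/
lemma ConstraintRegularAt.exists_lipschitz {x₀ : E} (h : ConstraintRegularAt V g x₀) :
    ∃ δ K : ℝ, 0 < δ ∧ 0 ≤ K ∧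
      (∀ x ∈ Metric.ball x₀ δ, UpperSemicontinuousOn (g x) V) ∧
      (∀ v ∈ V, ∀ x ∈ Metric.ball x₀ δ, ∀ y ∈ Metric.ball x₀ δ,
        |g x v - g y v| ≤ K * ‖x - y‖) ∧
      ∀ v₀ ∈ activeParams V g x₀, ∀ (x : ℕ → E) (v : ℕ → W) (x' : ℕ → E) (l : E),
        (∀ k, x k ∈ Metric.ball x₀ δ) → (∀ k, v k ∈ V) →
        (∀ k, x' k ∈ limitingSubdiff (fun y => g y (v k)) (x k)) →
        Tendsto x atTop (𝓝 x₀) → Tendsto v atTop (𝓝 v₀) → Tendsto x' atTop (𝓝 l) →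
        l ∈ limitingSubdiff (fun y => g y v₀) x₀ := by
  obtain ⟨δ, hδ, hu, ⟨K, hK⟩, hcl⟩ := h
  exact ⟨δ, |K|, hδ, abs_nonneg K, hu, fun v hv x hx y hy => (hK v hv x hx y hy).trans
    (mul_le_mul_of_nonneg_right (le_abs_self K) (norm_nonneg _)), hcl⟩

variable [FiniteDimensional ℝ E]

/-- Limits of proximal subgradients, at nearby points and nearly active parameters, are limiting
subgradients at active parameters. -/
lemma ConstraintRegularAt.exists_limit (hc : IsCompact V) {z : E}
    (h : ConstraintRegularAt V g z) :
    ∃ δ K : ℝ, 0 < δ ∧ ∀ (y : ℕ → E) (v : ℕ → W) (η : ℕ → E) (e : ℕ → ℝ),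
      (∀ k, y k ∈ Metric.ball z δ) → (∀ k, v k ∈ V) →
      (∀ k, IsProxSubgradient (fun x => g x (v k)) (y k) (η k)) →
      Tendsto y atTop (𝓝 z) → Tendsto e atTop (𝓝 0) →
      (∀ k, worstCase V g z - e k ≤ g z (v k)) →
      ∃ v₀ ∈ activeParams V g z, ∃ l ∈ limitingSubdiff (fun x => g x v₀) z, ‖l‖ ≤ K ∧
        ∃ s : ℕ → ℕ, StrictMono s ∧ Tendsto (η ∘ s) atTop (𝓝 l) := by
  obtain ⟨δ, K, hδ, hK, hu, hL, hcl⟩ := h.exists_lipschitz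
  refine ⟨δ, K, hδ, fun y v η e hy hv hη hyz he hle => ?_⟩
  have hηK : ∀ k, η k ∈ Metric.closedBall (0 : E) K := fun k => by
    rw [mem_closedBall_zero_iff]
    exact (hη k).norm_le hK (eventually_abs_sub_le_of_lipschitz (hL (v k) (hv k)) (hy k))
  obtain ⟨⟨v₀, l⟩, ⟨hv₀, hl⟩, s, hs, hlim⟩ :=
    (hc.prod (isCompact_closedBall (0 : E) K)).tendsto_subseq (x := fun k => (v k, η k))
      fun k => ⟨hv k, hηK k⟩
  have hlv : Tendsto (v ∘ s) atTop (𝓝 v₀) := (continuous_fst.tendsto _).comp hlim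
  have hlη : Tendsto (η ∘ s) atTop (𝓝 l) := (continuous_snd.tendsto _).comp hlim
  have hact : v₀ ∈ activeParams V g z :=
    mem_activeParams_of_tendsto hc (hu z (Metric.mem_ball_self hδ)) (fun k => hv (s k)) hv₀ hlv
      (he.comp hs.tendsto_atTop) fun k => hle (s k)
  refine ⟨v₀, hact, l, ?_, by simpa using hl, s, hs, hlη⟩
  exact hcl v₀ hact (y ∘ s) (v ∘ s) (η ∘ s) l (fun k => hy _) (fun k => hv _)
    (fun k => (hη (s k)).mem_limitingSubdiff (continuousAt_of_lipschitz (hL _ (hv _)) (hy _)))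
    (hyz.comp hs.tendsto_atTop) hlv hlη

/-- Proximal subgradients for a fixed active parameter exist at points tending to `z`, and
`exists_limit` supplies a limit. Nonemptiness is needed to separate from the hull and to treat zero
multipliers. -/
lemma ConstraintRegularAt.subgradients_nonempty (hne : V.Nonempty) (hc : IsCompact V) {z : E}
    (h : ConstraintRegularAt V g z) :
    (⋃ v ∈ activeParams V g z, limitingSubdiff (fun x => g x v) z).Nonempty := by
  obtain ⟨δ, K, hδ, hK, hu, hL, -⟩ := h.exists_lipschitz
  obtain ⟨δ', K', hδ', hlim⟩ := h.exists_limit hc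
  have hz := Metric.mem_ball_self (x := z) hδ
  obtain ⟨v, hv⟩ := exists_activeParams hne hc (hu z hz)
  choose y ξ hy hξ using fun k : ℕ => exists_isProxSubgradient_near hK (hL v hv.1) hz
    (lt_min hδ' (Nat.one_div_pos_of_nat (α := ℝ) (n := k)))
  have hyz : Tendsto y atTop (𝓝 z) := tendsto_iff_norm_sub_tendsto_zero.2
    (squeeze_zero (fun _ => norm_nonneg _) (fun k => ((hy k).trans_le (min_le_right _ _)).le)
      tendsto_one_div_add_atTop_nhds_zero_nat)
  obtain ⟨v₀, hv₀, l, hl, -⟩ := hlim y (fun _ => v) ξ (fun _ => 0)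
    (fun k => by rw [Metric.mem_ball, dist_eq_norm]; exact (hy k).trans_le (min_le_left _ _))
    (fun _ => hv.1) hξ hyz tendsto_const_nhds (fun _ => by rw [sub_zero, hv.2])
  exact ⟨l, mem_iUnion₂.2 ⟨v₀, hv₀, hl⟩⟩

/-- Near a point, a proximal subgradient of the worst-case function is dominated, in a given
direction, by a proximal subgradient of one of the functions `g · v` with `v` nearly active. -/
lemma exists_isProxSubgradient_of_worstCase (hne : V.Nonempty) (hc : IsCompact V) {z : E}
    {δ K : ℝ} (hK : 0 ≤ K) (hu : ∀ x ∈ Metric.ball z δ, UpperSemicontinuousOn (g x) V)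
    (hL : ∀ v ∈ V, ∀ x ∈ Metric.ball z δ, ∀ y ∈ Metric.ball z δ, |g x v - g y v| ≤ K * ‖x - y‖)
    {x ξ h : E} (hx : x ∈ Metric.ball z δ) (hξ : IsProxSubgradient (worstCase V g) x ξ)
    (hh : h ≠ 0) {ε : ℝ} (hε : 0 < ε) :
    ∃ y v η, y ∈ Metric.ball z δ ∧ ‖y - x‖ < ε ∧ v ∈ V ∧
      IsProxSubgradient (fun w => g w v) y η ∧ inner ℝ ξ h - ε ≤ inner ℝ η h ∧
      worstCase V g z - 2 * K * (‖x - z‖ + ε) ≤ g z v := by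
  have hz : z ∈ Metric.ball z δ := Metric.mem_ball_self (Metric.pos_of_mem_ball hx)
  have hh0 : 0 < ‖h‖ := norm_pos_iff.2 hh
  have h1 := tendsto_add_smul_nhdsGT x h
  have hts : 0 < min 1 (ε / (2 * ‖h‖)) := lt_min one_pos (by positivity)
  obtain ⟨t, ht1, ht2, ht3⟩ := ((hξ.eventually_dir h (half_pos hε)).and
    ((h1.eventually (Metric.isOpen_ball.mem_nhds hx)).and (Ioo_mem_nhdsGT hts))).exists
  have ht0 : 0 < t := ht3.1
  have htε : t * ‖h‖ < ε / 2 := by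
    have := ht3.2.trans_le (min_le_right _ _)
    rw [lt_div_iff₀ (by positivity)] at this
    linarith
  have ht1' : t < 1 := ht3.2.trans_le (min_le_left _ _)
  -- Taking `v` active at the far endpoint makes the increment of `g(·, v)` at least that of the
  -- maximum, since `g x v` is at most the maximum at `x`.
  obtain ⟨v, hv, hva⟩ := exists_activeParams hne hc (hu _ ht2)
  have hnorm : ‖x + t • h - x‖ = t * ‖h‖ := by
    rw [add_sub_cancel_left, norm_smul, Real.norm_eq_abs, abs_of_pos ht0]
  have hne' : x ≠ x + t • h := fun he => by
    have : t • h = 0 := by simpa using he.symm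
    simp [ht0.ne', hh] at this
  obtain ⟨y, η, hy, hyx, hη, hηi⟩ := exists_isProxSubgradient_mean_value hK (hL v hv) hx ht2 hne'
    (ε := t * (ε / 2)) (by positivity)
  rw [hnorm] at hyx
  refine ⟨y, v, η, hy, by nlinarith, hv, hη, ?_, ?_⟩
  · have h2 := le_worstCase hc (hu x hx) hv
    rw [add_sub_cancel_left, inner_smul_right] at hηi
    have : t * (inner ℝ ξ h - ε) ≤ t * inner ℝ η h := by linarith
    exact le_of_mul_le_mul_left this ht0
  · have h2 := (abs_le.1 (hL v hv _ ht2 _ hz)).2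
    have h3 := (abs_le.1 (worstCase_lipschitz hne hc hu hL _ ht2 _ hz)).1
    have h4 : ‖x + t • h - z‖ ≤ ‖x - z‖ + ε := by
      have := norm_sub_le_norm_sub_add_norm_sub (x + t • h) x z
      linarith
    have h5 := mul_le_mul_of_nonneg_left h4 hK
    linarith

/-- Limits of proximal subgradients of a worst-case function lie in the convex hull of the limiting
subgradients at active parameters. -/
theorem mem_convexHull_of_tendsto_isProxSubgradient (hne : V.Nonempty) (hc : IsCompact V) {z ξ : E}
    (hreg : ConstraintRegularAt V g z) {x w : ℕ → E} (hx : Tendsto x atTop (𝓝 z))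
    (hw : Tendsto w atTop (𝓝 ξ)) (hprox : ∀ k, IsProxSubgradient (worstCase V g) (x k) (w k)) :
    ξ ∈ convexHull ℝ (⋃ v ∈ activeParams V g z, limitingSubdiff (fun x => g x v) z) := by
  obtain ⟨δ, K, hδ, hK, hu, hL, hcl⟩ := hreg.exists_lipschitz
  obtain ⟨δ', K', hδ', hlim⟩ := hreg.exists_limit hc
  have hz := Metric.mem_ball_self (x := z) hδ
  set D := ⋃ v ∈ activeParams V g z, limitingSubdiff (fun x => g x v) z with hD
  obtain ⟨l₀, hl₀⟩ : D.Nonempty := hreg.subgradients_nonempty hne hc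
  -- Truncation makes the set compact without bounding all limiting subgradients. The radius admits
  -- every limit from `exists_limit` and also `l₀`, so the truncated set is nonempty and the
  -- separating functional is nonzero.
  set R := max K' ‖l₀‖ with hR
  set D' := D ∩ Metric.closedBall 0 R with hD'
  have hcomp : IsCompact D' := by
    refine (isCompact_closedBall (0 : E) R).of_isClosed_subset (IsSeqClosed.isClosed ?_)
      inter_subset_right
    intro η l hη hl
    refine ⟨?_, Metric.isClosed_closedBall.isSeqClosed (fun k => (hη k).2) hl⟩
    choose v hv hηv using fun k => mem_iUnion₂.1 (hη k).1
    obtain ⟨v₀, hv₀, s, hs, hvs⟩ := hc.tendsto_subseq fun k => (hv k).1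
    have hact : v₀ ∈ activeParams V g z :=
      mem_activeParams_of_tendsto hc (hu z hz) (fun k => (hv (s k)).1) hv₀ hvs
        tendsto_const_nhds fun k => by rw [sub_zero, (hv (s k)).2]
    exact mem_iUnion₂.2 ⟨v₀, hact, hcl v₀ hact (fun _ => z) (v ∘ s) (η ∘ s) l (fun _ => hz)
      (fun k => (hv _).1) (fun k => hηv (s k)) tendsto_const_nhds hvs (hl.comp hs.tendsto_atTop)⟩
  refine convexHull_mono (inter_subset_left (t := Metric.closedBall 0 R)) ?_
  by_contra hnot
  obtain ⟨f, u, hfu, huf⟩ := geometric_hahn_banach_closed_point (convex_convexHull ℝ D')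
    hcomp.convexHull_of_finiteDimensional.isClosed hnot
  obtain ⟨h, rfl⟩ := (InnerProductSpace.toDual ℝ E).surjective f
  simp only [InnerProductSpace.toDual_apply_apply] at hfu huf
  have hh : h ≠ 0 := by
    rintro rfl
    have := hfu l₀ (subset_convexHull ℝ D' ⟨hl₀, by simp [hR]⟩)
    rw [inner_zero_left] at this huf
    linarith
  have step : ∀ m : ℕ, ∃ y v η, y ∈ Metric.ball z δ' ∧ ‖y - z‖ ≤ 2 * (1 / ((m : ℝ) + 1)) ∧ v ∈ V ∧
      IsProxSubgradient (fun x => g x v) y η ∧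
      inner ℝ ξ h - 2 * (1 / ((m : ℝ) + 1)) ≤ inner ℝ η h ∧
      worstCase V g z - 4 * K * (1 / ((m : ℝ) + 1)) ≤ g z v := by
    intro m
    have hm : 0 < 1 / ((m : ℝ) + 1) := Nat.one_div_pos_of_nat
    -- The steps from `z` to `x k` and from `x k` to `y` are each shorter than `δ' / 2`, so `y` lies
    -- in the ball required by `hlim`.
    have hε : 0 < min (δ' / 2) (1 / ((m : ℝ) + 1)) := lt_min (half_pos hδ') hm
    have hi : Tendsto (fun k => inner ℝ (w k) h) atTop (𝓝 (inner ℝ ξ h)) :=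
      hw.inner tendsto_const_nhds
    obtain ⟨k, hk1, hk2, hk3⟩ := ((hx.eventually (Metric.isOpen_ball.mem_nhds hz)).and
      ((hx.eventually (Metric.ball_mem_nhds z hε)).and
        (hi.eventually_const_lt (sub_lt_self _ hm)))).exists
    obtain ⟨y, v, η, -, hyx, hv, hη, hηi, hgv⟩ :=
      exists_isProxSubgradient_of_worstCase hne hc hK hu hL hk1 (hprox k) hh hε
    rw [dist_eq_norm] at hk2
    have h1 := norm_sub_le_norm_sub_add_norm_sub y (x k) z
    have h2 := min_le_left (δ' / 2) (1 / ((m : ℝ) + 1))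
    have h3 := min_le_right (δ' / 2) (1 / ((m : ℝ) + 1))
    refine ⟨y, v, η, ?_, by linarith, hv, hη, by linarith, ?_⟩
    · rw [Metric.mem_ball, dist_eq_norm]; linarith
    · have h4 : ‖x k - z‖ + min (δ' / 2) (1 / ((m : ℝ) + 1)) ≤ 2 * (1 / ((m : ℝ) + 1)) := by
        linarith
      have := mul_le_mul_of_nonneg_left h4 hK
      linarith
  choose y v η hyδ hyz hv hη hηi hgv using step
  have h0 : ∀ c : ℝ, Tendsto (fun m : ℕ => c * (1 / ((m : ℝ) + 1))) atTop (𝓝 0) := fun c => by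
    simpa using tendsto_one_div_add_atTop_nhds_zero_nat.const_mul c
  obtain ⟨v₀, hv₀, l, hl, hlK, s, hs, hsl⟩ := hlim y v η _ hyδ hv hη
    (tendsto_iff_norm_sub_tendsto_zero.2 (squeeze_zero (fun _ => norm_nonneg _) hyz (h0 2)))
    (h0 (4 * K)) hgv
  have h1 : inner ℝ ξ h ≤ inner ℝ l h := by
    refine le_of_tendsto_of_tendsto' (b := atTop)
      (f := fun m => inner ℝ ξ h - 2 * (1 / ((s m : ℝ) + 1))) ?_
      (hsl.inner tendsto_const_nhds) fun m => hηi (s m)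
    have h2 := tendsto_const_nhds (x := inner ℝ ξ h) |>.sub ((h0 2).comp hs.tendsto_atTop)
    rwa [sub_zero] at h2
  have h2 := hfu l (subset_convexHull ℝ D' ⟨mem_iUnion₂.2 ⟨v₀, hv₀, hl⟩,
    mem_closedBall_zero_iff.2 (hlK.trans (le_max_left _ _))⟩)
  rw [real_inner_comm] at h2 huf
  linarith

end SupRule

/-! ### Local Lipschitz bounds. -/

/-- `f` is Lipschitz on some ball around `z`. -/
def IsLipschitzNear {E : Type*} [NormedAddCommGroup E] (f : E → ℝ) (z : E) : Prop :=
  ∃ δ L : ℝ, 0 < δ ∧ 0 ≤ L ∧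
    ∀ x ∈ Metric.ball z δ, ∀ y ∈ Metric.ball z δ, |f x - f y| ≤ L * ‖x - y‖

section IsLipschitzNear

variable {E : Type*} [NormedAddCommGroup E]

lemma IsLipschitzNear.continuousAt {f : E → ℝ} {z : E} (h : IsLipschitzNear f z) :
    ContinuousAt f z := by
  obtain ⟨δ, L, hδ, -, hf⟩ := h
  exact continuousAt_of_lipschitz hf (Metric.mem_ball_self hδ)

lemma LocallyLipschitz.isLipschitzNear {f : E → ℝ} (h : LocallyLipschitz f) (z : E) :
    IsLipschitzNear f z := by
  obtain ⟨K, t, ht, hK⟩ := h z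
  obtain ⟨δ, hδ, hδt⟩ := Metric.mem_nhds_iff.1 ht
  refine ⟨δ, K, hδ, K.2, fun x hx y hy => ?_⟩
  rw [← Real.dist_eq, ← dist_eq_norm]
  exact hK.dist_le_mul x (hδt hx) y (hδt hy)

lemma IsLipschitzNear.const_mul {f : E → ℝ} {z : E} (h : IsLipschitzNear f z) (c : ℝ) :
    IsLipschitzNear (fun x => c * f x) z := by
  obtain ⟨δ, L, hδ, hL, hf⟩ := h
  refine ⟨δ, |c| * L, hδ, by positivity, fun x hx y hy => ?_⟩
  rw [← mul_sub, abs_mul, mul_assoc]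
  exact mul_le_mul_of_nonneg_left (hf x hx y hy) (abs_nonneg c)

lemma IsLipschitzNear.add {f g : E → ℝ} {z : E} (hf : IsLipschitzNear f z)
    (hg : IsLipschitzNear g z) : IsLipschitzNear (fun x => f x + g x) z := by
  obtain ⟨δ, L, hδ, hL, hf⟩ := hf
  obtain ⟨δ', L', hδ', hL', hg⟩ := hg
  refine ⟨min δ δ', L + L', lt_min hδ hδ', add_nonneg hL hL', fun x hx y hy => ?_⟩
  have h1 := Metric.ball_subset_ball (x := z) (min_le_left δ δ')
  have h2 := Metric.ball_subset_ball (x := z) (min_le_right δ δ')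
  rw [add_sub_add_comm, add_mul]
  exact (abs_add_le _ _).trans
    (add_le_add (hf x (h1 hx) y (h1 hy)) (hg x (h2 hx) y (h2 hy)))

lemma isLipschitzNear_sum {ι : Type*} (s : Finset ι) {F : ι → E → ℝ} {z : E}
    (h : ∀ i, IsLipschitzNear (F i) z) : IsLipschitzNear (fun x => ∑ i ∈ s, F i x) z := by
  classical
  induction s using Finset.induction_on with
  | empty => exact ⟨1, 0, one_pos, le_rfl, by simp⟩
  | insert a s ha ih => simpa only [Finset.sum_insert ha] using (h a).add ih

lemma isLipschitzNear_norm_sub (w z : E) : IsLipschitzNear (fun x => ‖x - w‖) z :=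
  ⟨1, 1, one_pos, zero_le_one, fun x _ y _ => by
    simpa using abs_norm_sub_norm_le (x - w) (y - w)⟩

lemma exists_common_lipschitz {ι : Type*} [Fintype ι] {F : ι → E → ℝ} {z : E}
    (h : ∀ i, IsLipschitzNear (F i) z) :
    ∃ L : ℝ, 0 ≤ L ∧ ∀ᶠ r in 𝓝[>] (0 : ℝ), ∀ i, ∀ x ∈ Metric.closedBall z r,
      ∀ y ∈ Metric.closedBall z r, |F i x - F i y| ≤ L * ‖x - y‖ := by
  choose δ L hδ hL hF using h
  refine ⟨∑ i, L i, Finset.sum_nonneg fun i _ => hL i, eventually_all.2 fun i => ?_⟩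
  filter_upwards [Ioo_mem_nhdsGT (hδ i)] with r hr x hx y hy
  have h1 := Metric.closedBall_subset_ball (x := z) hr.2
  exact (hF i x (h1 hx) y (h1 hy)).trans (mul_le_mul_of_nonneg_right
    (Finset.single_le_sum (fun j _ => hL j) (Finset.mem_univ i)) (norm_nonneg _))

end IsLipschitzNear

/-! ### Limiting sum rule, multiplier rule and variational principle. -/

section Optimality

variable {E : Type*} [NormedAddCommGroup E] [InnerProductSpace ℝ E]

lemma ConstraintRegularAt.isLipschitzNear {W : Type*} [MetricSpace W] {V : Set W} {g : E → W → ℝ}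
    (hne : V.Nonempty) (hc : IsCompact V) {z : E} (h : ConstraintRegularAt V g z) :
    IsLipschitzNear (worstCase V g) z := by
  obtain ⟨δ, K, hδ, hK, hu, hL, -⟩ := h.exists_lipschitz
  exact ⟨δ, K, hδ, hK, worstCase_lipschitz hne hc hu hL⟩

variable [FiniteDimensional ℝ E]

/-- Sum rule: at a minimizer of a sum of Lipschitz functions over a closed set, up to a quadratic
term, zero is the sum of a limiting normal and of limits of proximal subgradients. -/
theorem exists_limit_isProxSubgradient_sum {ι : Type*} [Fintype ι] {F : ι → E → ℝ} {S : Set E}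
    (hS : IsClosed S) {z : E} (hz : z ∈ S) (hF : ∀ i, IsLipschitzNear (F i) z) {C : ℝ} (hC : 0 ≤ C)
    (hmin : ∀ᶠ x in 𝓝[S] z, ∑ i, F i z ≤ ∑ i, F i x + C * ‖x - z‖ ^ 2) :
    ∃ ξ : ι → E, ∃ ν ∈ limitingNormalCone z S, ∑ i, ξ i + ν = 0 ∧
      ∀ i, ∃ x w : ℕ → E, Tendsto x atTop (𝓝 z) ∧ Tendsto w atTop (𝓝 (ξ i)) ∧
        ∀ k, IsProxSubgradient (F i) (x k) (w k) := by
  obtain ⟨L, hL0, hL⟩ := exists_common_lipschitz hF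
  obtain ⟨δ, hδ, hδmin⟩ := Metric.eventually_nhds_iff_ball.1 (eventually_nhdsWithin_iff.1 hmin)
  obtain ⟨r, hr, hr0, hrδ⟩ := (hL.and (Ioo_mem_nhdsGT hδ)).exists
  choose x w y ν hx hw hy hyz hν hsum using fun k : ℕ =>
    exists_proxSubgradient_sum hS hz hr0 hL0 hr hC
      (fun x hx => hδmin x (Metric.closedBall_subset_ball hrδ hx.2) hx.1)
      (lt_min hr0 (Nat.one_div_pos_of_nat (α := ℝ) (n := k)))
  have hto : ∀ {u : ℕ → E} {a : E}, (∀ k : ℕ, ‖u k - a‖ < min r (1 / ((k : ℝ) + 1))) →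
      Tendsto u atTop (𝓝 a) := fun {u a} h => tendsto_iff_norm_sub_tendsto_zero.2
    (squeeze_zero (fun _ => norm_nonneg _) (fun k => ((h k).trans_le (min_le_right _ _)).le)
      tendsto_one_div_add_atTop_nhds_zero_nat)
  have hwL : ∀ k, w k ∈ univ.pi fun _ : ι => Metric.closedBall (0 : E) L := fun k i _ => by
    rw [mem_closedBall_zero_iff]
    refine (hw k i).norm_le hL0 (eventually_abs_sub_le_of_lipschitz (x₀ := z) (δ := r)
      (fun u hu v hv => hr i u (Metric.ball_subset_closedBall hu) v
        (Metric.ball_subset_closedBall hv)) ?_)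
    rw [Metric.mem_ball, dist_eq_norm]
    exact (hx k i).trans_le (min_le_left _ _)
  obtain ⟨ξ, -, s, hs, hlim⟩ :=
    (isCompact_univ_pi fun _ : ι => isCompact_closedBall (0 : E) L).tendsto_subseq hwL
  have hlimi : ∀ i, Tendsto (fun k => w (s k) i) atTop (𝓝 (ξ i)) := fun i =>
    tendsto_pi_nhds.1 hlim i
  -- No a priori bound on the normals is needed: they converge because the subgradients do and the
  -- total tends to zero.
  have hν0 : Tendsto (fun k => ν (s k)) atTop (𝓝 (-∑ i, ξ i)) := by
    have h1 : Tendsto (fun k => ∑ i, w k i + ν k) atTop (𝓝 0) := hto fun k => by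
      simpa using hsum k
    have h2 := (h1.comp hs.tendsto_atTop).sub (tendsto_finsetSum Finset.univ fun i _ => hlimi i)
    simpa using h2
  exact ⟨ξ, -∑ i, ξ i, mem_limitingNormalCone_of_prox (fun k => hy (s k))
    ((hto hyz).comp hs.tendsto_atTop) hν0 (fun k => hν (s k)), add_neg_cancel _,
    fun i => ⟨fun k => x (s k) i, fun k => w (s k) i,
      (hto fun k => hx k i).comp hs.tendsto_atTop, hlimi i, fun k => hw (s k) i⟩⟩

/-- Multiplier rule for a minimizer of the sum of a Lipschitz function, a multiple of the distance
to the minimizer, and weighted worst-case functions. -/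
theorem zero_mem_of_minimizer {J : Type*} [Fintype J] {W : J → Type*} [∀ j, MetricSpace (W j)]
    {S : Set E} (hS : IsClosed S) {V : ∀ j, Set (W j)} (hne : ∀ j, (V j).Nonempty)
    (hc : ∀ j, IsCompact (V j)) {g : ∀ j, E → W j → ℝ} {z : E} (hz : z ∈ S)
    (hg : ∀ j, ConstraintRegularAt (V j) (g j) z) {φ : E → ℝ} (hφ : IsLipschitzNear φ z)
    {lam : J → ℝ} (hlam : ∀ j, 0 ≤ lam j) {τ C : ℝ} (hτ : 0 ≤ τ) (hC : 0 ≤ C)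
    (hmin : ∀ᶠ x in 𝓝[S] z, φ z + ∑ j, lam j * worstCase (V j) (g j) z ≤
      φ x + τ * ‖x - z‖ + ∑ j, lam j * worstCase (V j) (g j) x + C * ‖x - z‖ ^ 2) :
    (0 : E) ∈ limitingSubdiff φ z
      + ∑ j, lam j • convexHull ℝ
          (⋃ v ∈ activeParams (V j) (g j) z, limitingSubdiff (fun x => g j x v) z)
      + limitingNormalCone z S + τ • Metric.closedBall (0 : E) 1 := by
  let F : Option (Option J) → E → ℝ := fun i => match i with
    | none => φ
    | some none => fun x => τ * ‖x - z‖
    | some (some j) => fun x => lam j * worstCase (V j) (g j) x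
  have hF : ∀ i, IsLipschitzNear (F i) z := by
    rintro (_ | _ | j)
    · exact hφ
    · exact (isLipschitzNear_norm_sub z z).const_mul τ
    · exact ((hg j).isLipschitzNear (hne j) (hc j)).const_mul (lam j)
  obtain ⟨ξ, ν, hν, hsum, hlim⟩ := exists_limit_isProxSubgradient_sum hS hz hF hC (by
    filter_upwards [hmin] with x hx
    simp only [Fintype.sum_option, F, sub_self, norm_zero, mul_zero]
    linarith)
  have hφξ : ξ none ∈ limitingSubdiff φ z := by
    obtain ⟨x, w, hx, hw, h⟩ := hlim none
    exact mem_limitingSubdiff_of_prox hφ.continuousAt hx hw h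
  have hball : ξ (some none) ∈ τ • Metric.closedBall (0 : E) 1 := by
    obtain ⟨x, w, -, hw, h⟩ := hlim (some none)
    rw [smul_closedBall _ _ zero_le_one, smul_zero, Real.norm_of_nonneg hτ, mul_one]
    refine Metric.isClosed_closedBall.mem_of_tendsto hw (Eventually.of_forall fun k => ?_)
    rw [mem_closedBall_zero_iff]
    refine (h k).norm_le hτ (Eventually.of_forall fun u => ?_)
    simp only [F]
    rw [← mul_sub, abs_mul, abs_of_nonneg hτ]
    refine mul_le_mul_of_nonneg_left ?_ hτ
    simpa using abs_norm_sub_norm_le (u - z) (x k - z)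
  have hsup : ∀ j, ξ (some (some j)) ∈ lam j • convexHull ℝ
      (⋃ v ∈ activeParams (V j) (g j) z, limitingSubdiff (fun x => g j x v) z) := by
    intro j
    obtain ⟨x, w, hx, hw, h⟩ := hlim (some (some j))
    rcases (hlam j).eq_or_lt with h0 | h0
    -- Dividing by `lam j` is impossible here. The scaled hull is `{0}` because the hull is
    -- nonempty, and the subgradients of the zero function vanish.
    · rw [← h0, zero_smul_set ((hg j).subgradients_nonempty (hne j) (hc j)).convexHull]
      have hw0 : ∀ k, w k = 0 := fun k => norm_le_zero_iff.1 <|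
        (h k).norm_le le_rfl (Eventually.of_forall fun u => by simp [F, ← h0])
      exact tendsto_nhds_unique hw (by simpa only [funext hw0] using tendsto_const_nhds)
    · rw [mem_smul_set_iff_inv_smul_mem₀ h0.ne']
      exact mem_convexHull_of_tendsto_isProxSubgradient (hne j) (hc j) (hg j) hx
        (hw.const_smul (lam j)⁻¹) fun k => (h k).of_const_mul h0
  have hz0 : ξ none + ∑ j, ξ (some (some j)) + ν + ξ (some none) = 0 := by
    rw [← hsum]
    simp only [Fintype.sum_option]
    abel
  have hmem := Set.add_mem_add (Set.add_mem_add (Set.add_mem_add hφξ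
    (Set.finsetSum_mem_finsetSum Finset.univ _ _ fun j _ => hsup j)) hν) hball
  rwa [hz0] at hmem

/-- A form of the Ekeland variational principle in finite dimension. -/
lemma exists_ekeland_point {S : Set E} (hS : IsClosed S) {P : E → ℝ} (hP : ContinuousOn P S) {m : ℝ}
    (hm : ∀ x ∈ S, m ≤ P x) {x₀ : E} (hx₀ : x₀ ∈ S) {τ : ℝ} (hτ : 0 < τ) :
    ∃ z ∈ S, P z ≤ P x₀ ∧ ∀ x ∈ S, P z ≤ P x + τ * ‖x - z‖ := by
  set R := (P x₀ - m) / τ with hR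
  have hR0 : 0 ≤ R := div_nonneg (sub_nonneg.2 (hm x₀ hx₀)) hτ.le
  have hRτ : τ * R = P x₀ - m := by rw [hR]; field_simp
  obtain ⟨z, ⟨hzS, hzB⟩, hz⟩ := ((isCompact_closedBall x₀ R).inter_left hS).exists_isMinOn
    (f := fun x => P x + τ * ‖x - x₀‖) ⟨x₀, hx₀, Metric.mem_closedBall_self hR0⟩
    ((hP.mono inter_subset_left).add (by fun_prop))
  have hz0 : P z + τ * ‖z - x₀‖ ≤ P x₀ := by
    have := hz ⟨hx₀, Metric.mem_closedBall_self hR0⟩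
    simpa using this
  refine ⟨z, hzS, by nlinarith [norm_nonneg (z - x₀)], fun x hx => ?_⟩
  -- Outside the ball of radius `R = (P x₀ - m) / τ` the distance term alone lifts the value above
  -- `P x₀`, so the minimizer on the ball is global on `S`.
  have key : P z + τ * ‖z - x₀‖ ≤ P x + τ * ‖x - x₀‖ := by
    by_cases hxB : x ∈ Metric.closedBall x₀ R
    · exact hz ⟨hx, hxB⟩
    · rw [Metric.mem_closedBall, dist_eq_norm, not_le] at hxB
      nlinarith [hm x hx]
  have h1 := norm_sub_le_norm_sub_add_norm_sub x z x₀
  nlinarith [mul_le_mul_of_nonneg_left h1 hτ.le]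

end Optimality

/-! ### Quadratic penalization and the main theorem. -/

/-- The function `t ↦ max(t, 0)²` has the `2`-Lipschitz derivative `2 max(t, 0)`, hence this
quadratic upper bound at `a`. -/
lemma sq_max_zero_le (a b : ℝ) :
    max b 0 ^ 2 ≤ max a 0 ^ 2 + 2 * max a 0 * (b - a) + (b - a) ^ 2 := by
  rcases le_total a 0 with ha | ha <;> rcases le_total b 0 with hb | hb <;>
    simp only [max_eq_left, max_eq_right, ha, hb] <;> nlinarith [sq_nonneg b]

theorem mainTheorem2 (n m p : ℕ) (d : Fin p → ℕ)
    (S : Set (EuclideanSpace ℝ (Fin n))) (hS : IsClosed S)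
    (V : ∀ j : Fin p, Set (EuclideanSpace ℝ (Fin (d j))))
    (hVne : ∀ j, (V j).Nonempty) (hVc : ∀ j, IsCompact (V j))
    (fL fU : Fin m → EuclideanSpace ℝ (Fin n) → ℝ)
    (hfL : ∀ i, LocallyLipschitz (fL i)) (hfU : ∀ i, LocallyLipschitz (fU i))
    (hf : ∀ i, ∀ x ∈ S, fL i x ≤ fU i x)
    (g : ∀ j : Fin p, EuclideanSpace ℝ (Fin n) → EuclideanSpace ℝ (Fin (d j)) → ℝ)
    (hg : ∀ j x₀, ConstraintRegularAt (V j) (g j) x₀)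
    (εL εU : Fin m → ℝ) (hεL : ∀ i, 0 ≤ εL i) (hεU : ∀ i, εL i ≤ εU i)
    (hθ : 0 < totalTolerance εL εU)
    (hΩ : (feasibleSet S V g).Nonempty)
    (hbdd : BddBelow (scalarObjective fL fU '' S)) :
    ∃ (z : EuclideanSpace ℝ (Fin n)) (lam : Fin p → ℝ),
      IsAlmostRegularSolution S V g (scalarObjective fL fU) (totalTolerance εL εU) z ∧
      (∀ j, 0 ≤ lam j) ∧
      (0 : EuclideanSpace ℝ (Fin n)) ∈
        limitingSubdiff (scalarObjective fL fU) z
          + ∑ j, lam j • convexHull ℝ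
              (⋃ v ∈ activeParams (V j) (g j) z, limitingSubdiff (fun x => g j x v) z)
          + limitingNormalCone z S
          + √(totalTolerance εL εU) • Metric.closedBall (0 : EuclideanSpace ℝ (Fin n)) 1 ∧
      (∀ j, 0 < worstCase (V j) (g j) z ∧
          worstCase (V j) (g j) z ≤ √(totalTolerance εL εU) → 0 < lam j) ∧
      (∀ j, worstCase (V j) (g j) z ≤ 0 → lam j = 0) := by
  set θ := totalTolerance εL εU with hθdef
  set φ := scalarObjective fL fU with hφdef
  set G : Fin p → EuclideanSpace ℝ (Fin n) → ℝ := fun j => worstCase (V j) (g j) with hG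
  have hφL : ∀ z, IsLipschitzNear φ z := fun z =>
    isLipschitzNear_sum _ fun i => ((hfL i).isLipschitzNear z).add ((hfU i).isLipschitzNear z)
  have hGL : ∀ j z, IsLipschitzNear (G j) z := fun j z =>
    (hg j z).isLipschitzNear (hVne j) (hVc j)
  have hφc : Continuous φ := continuous_iff_continuousAt.2 fun z => (hφL z).continuousAt
  have hGc : ∀ j, Continuous (G j) := fun j =>
    continuous_iff_continuousAt.2 fun z => (hGL j z).continuousAt
  obtain ⟨M, hM⟩ := hbdd
  replace hM : ∀ x ∈ S, M ≤ φ x := fun x hx => hM (mem_image_of_mem φ hx)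
  obtain ⟨ω, hω⟩ := hΩ
  have hGneg : ∀ x ∈ feasibleSet S V g, ∀ j, G j x ≤ 0 := fun x hx j =>
    csSup_le ((hVne j).image _) (by rintro _ ⟨v, hv, rfl⟩; exact hx.2 j v hv)
  set T := φ ω + θ - M with hT
  have hT0 : 0 < T := by linarith [hM ω hω.1]
  -- Feasibility will follow from `ρ max(G j z, 0)² ≤ P z - φ z ≤ φ ω + θ - M = T = ρ θ`.
  set ρ := T / θ with hρ
  have hρ0 : 0 < ρ := div_pos hT0 hθ
  set P : EuclideanSpace ℝ (Fin n) → ℝ := fun x => φ x + ρ * ∑ j, max (G j x) 0 ^ 2 with hP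
  have hφP : ∀ x, φ x ≤ P x := fun x => le_add_of_nonneg_right
    (mul_nonneg hρ0.le (Finset.sum_nonneg fun _ _ => sq_nonneg _))
  have hPΩ : ∀ x ∈ feasibleSet S V g, P x = φ x := fun x hx => by
    simp [hP, max_eq_right (hGneg x hx _)]
  have hPc : Continuous P := by fun_prop
  have hMP : ∀ x ∈ S, M ≤ P x := fun x hx => (hM x hx).trans (hφP x)
  obtain ⟨_, ⟨x₀, hx₀, rfl⟩, hx₀lt⟩ :=
    exists_lt_of_csInf_lt (Set.Nonempty.image P ⟨ω, hω.1⟩) (lt_add_of_pos_right (sInf (P '' S)) hθ)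
  have hx₀le : ∀ x ∈ S, P x₀ ≤ P x + θ := fun x hx => by
    have := csInf_le ⟨M, by rintro _ ⟨y, hy, rfl⟩; exact hMP y hy⟩ (mem_image_of_mem P hx)
    linarith
  obtain ⟨z, hzS, hz0, hzmin⟩ :=
    exists_ekeland_point hS hPc.continuousOn hMP hx₀ (Real.sqrt_pos.2 hθ)
  have hzΩ : z ∈ relaxedFeasibleSet S V g θ := by
    refine ⟨hzS, fun j => (le_max_left (G j z) 0).trans (Real.le_sqrt_of_sq_le ?_)⟩
    have h1 : max (G j z) 0 ^ 2 ≤ ∑ j, max (G j z) 0 ^ 2 :=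
      Finset.single_le_sum (f := fun j => max (G j z) 0 ^ 2) (fun _ _ => sq_nonneg _)
        (Finset.mem_univ j)
    have h2 : P z ≤ φ ω + θ := by linarith [hx₀le ω hω.1, hPΩ ω hω]
    have h3 : ρ * θ = T := div_mul_cancel₀ T hθ.ne'
    have h4 : P z = φ z + ρ * ∑ j, max (G j z) 0 ^ 2 := rfl
    refine le_of_mul_le_mul_left ?_ hρ0
    linarith [mul_le_mul_of_nonneg_left h1 hρ0.le, hM z hzS]
  refine ⟨z, fun j => 2 * ρ * max (G j z) 0, ⟨⟨hzΩ, fun x hx => ?_⟩, hzΩ, fun x hx => ?_⟩,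
    fun j => by positivity, ?_, fun j hj => ?_, fun j hj => ?_⟩
  · have := hx₀le x hx.1
    rw [hPΩ x hx] at this
    linarith [hφP z]
  · have := hzmin x hx.1
    rw [hPΩ x hx] at this
    linarith [hφP z]
  · choose δ L hδ hL hGLip using fun j => hGL j z
    have hloc : ∀ᶠ x in 𝓝 z, ∀ j, x ∈ Metric.ball z (δ j) :=
      eventually_all.2 fun j => Metric.ball_mem_nhds z (hδ j)
    refine zero_mem_of_minimizer hS hVne hVc hzS (fun j => hg j z) (hφL z)
      (fun j => by positivity) (Real.sqrt_nonneg θ) (C := ρ * ∑ j, L j ^ 2)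
      (mul_nonneg hρ0.le (Finset.sum_nonneg fun _ _ => sq_nonneg _)) ?_
    -- Near `z` the quadratic remainder of each linearized penalty is at most `L j ^ 2 * ‖x - z‖ ^
    -- 2`, which gives the constant `C`.
    filter_upwards [self_mem_nhdsWithin, hloc.filter_mono nhdsWithin_le_nhds] with x hxS hx
    have h1 : ∑ j, max (G j x) 0 ^ 2 ≤ ∑ j, (max (G j z) 0 ^ 2
        + 2 * max (G j z) 0 * (G j x - G j z) + L j ^ 2 * ‖x - z‖ ^ 2) := by
      refine Finset.sum_le_sum fun j _ => (sq_max_zero_le (G j z) (G j x)).trans ?_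
      have h2 := hGLip j x (hx j) z (Metric.mem_ball_self (hδ j))
      have h3 := pow_le_pow_left₀ (abs_nonneg _) h2 2
      rw [sq_abs, mul_pow] at h3
      linarith
    have h2 : P z = φ z + ρ * ∑ j, max (G j z) 0 ^ 2 := rfl
    have h3 : P x = φ x + ρ * ∑ j, max (G j x) 0 ^ 2 := rfl
    have h4 : ∀ y, ∑ j, 2 * ρ * max (G j z) 0 * G j y
        = ρ * ∑ j, 2 * max (G j z) 0 * G j y := fun y => by
      rw [Finset.mul_sum]; exact Finset.sum_congr rfl fun j _ => by ring
    have h5 := mul_le_mul_of_nonneg_left h1 hρ0.le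
    simp only [Finset.sum_add_distrib, mul_sub, Finset.sum_sub_distrib, ← Finset.sum_mul] at h5
    have h6 := hzmin x hxS
    change φ z + ∑ j, 2 * ρ * max (G j z) 0 * G j z ≤ φ x + √θ * ‖x - z‖
      + ∑ j, 2 * ρ * max (G j z) 0 * G j x + (ρ * ∑ j, L j ^ 2) * ‖x - z‖ ^ 2
    rw [h4, h4]
    linarith
  · have : 0 < max (G j z) 0 := lt_max_of_lt_left hj.1
    positivity
  · simp [max_eq_right (show G j z ≤ 0 from hj)]
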